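/- **Setting.** A *time scale* is a closed set $\mathbb T\subset\mathbb R$ with $0\in\mathbb T$ whose set $\mathbb S$ of right-scattered points is unbounded above. Here $\sigma(t)=\inf\{s\in\mathbb T: s>t\}$ and $\mu(t)=\sigma(t)-t$ for $t\in\mathbb T$; $\mathbb S=\{t\in\mathbb T:\sigma(t)>t\}$, $\mathbb D=\{t\in\mathbb T:\sigma(t)=t\}$ (right-dense points), $\mathbb T_0^+=\mathbb T\cap[0,\infty)$, and $[t]_{\mathbb T}=\sup(\mathbb T\cap(-\infty,t])$. Matrices are complex $n\times n$, $|\cdot|$ is the operator norm for the Euclidean norm on $\mathbb C^n$, $E_n$ is the identity matrix, and $\|\cdot\|_\infty$ is the sup norm on $\mathbb T_0^+$ or on $\mathbb R_+=[0,\infty)$. A matrix function on $\mathbb T_0^+$ is *rd-continuous* if it is continuous at right-dense points and has finite left limits at left-dense points. It is *uniformly regressive* if $E_n+\mu(t)\mathcal A(t)$ is invertible for all $t\in\mathbb T_0^+$ and $(E_n+\mu\mathcal A)^{-1}$ is bounded on $\mathbb T_0^+$. An *extension* of a matrix function $\mathcal A$ on $\mathbb T_0^+$ is a function $\widetilde{\mathcal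 A}$ on $\mathbb R_+$ with $\widetilde{\mathcal A}(t)=\mathcal A(t)$ for $t\in\mathbb D\cap\mathbb T_0^+$ and $$\widetilde{\mathcal A}(t)=\frac1{\mu([t]_{\mathbb T})}\operatorname{Log}\bigl(E_n+\mu([t]_{\mathbb T})\mathcal A([t]_{\mathbb T})\bigr),\qquad t\in\mathbb R_+\setminus\mathbb D,$$ where the value of the multivalued matrix logarithm is the same along each gap $[s,\sigma(s))$, $s\in\mathbb S\cap\mathbb T_0^+$. Given $\mathcal A$, $\widetilde{\mathcal A}$ and a matrix function $\widehat{\mathcal B}$ on $\mathbb R_+$, let $\widetilde\Phi(t,s)$ be the fundamental matrix of $\dot x=(\widetilde{\mathcal A}(t)+\widehat{\mathcal B}(t))x$ (solutions being understood through the integral equation), and put $$\widetilde{\mathcal L}[\widehat{\mathcal B}](t)=\begin{cases}\widehat{\mathcal B}(t),& t\in\mathbb D\cap\mathbb T_0^+,\\[2pt] \dfrac{\widetilde\Phi(\sigma(t),t)-E_n}{\mu(t)}-\mathcal A(t),& t\in\mathbb S\cap\mathbb T_0^+.\end{cases}\tag{5.4}$$ For $S>0$ and $\delta>0$ let $\mathcal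 P_{S,\delta}(\mathbb T)$ be the set of continuous matrix functions $\widehat{\mathcal B}$ on $\mathbb R_+$ with $\|\widehat{\mathcal B}\|_\infty\le\delta$ and $\widehat{\mathcal B}(t)=0$ whenever $\operatorname{dist}(t,\mathbb T)>S$. **Theorem 5.3.** For all $n$, real $a,\rho,\alpha$ and $S>0$ there is $\delta_0=\delta_0(n,a,\rho,\alpha,S)>0$, and for every $\delta\in(0,\delta_0]$ there is $K=K(n,a,\rho,\alpha,S,\delta)\ge0$, such that the following holds for every time scale $\mathbb T$, every rd-continuous, uniformly regressive $\mathcal A$ on $\mathbb T_0^+$ with $\|\mathcal A\|_\infty\le a$ and $\|(E_n+\mu\mathcal A)^{-1}\|_\infty\le\rho$, and every extension $\widetilde{\mathcal A}$ of $\mathcal A$ with $\|\widetilde{\mathcal A}\|_\infty\le\alpha$. 1. For every $\widehat{\mathcal B}\in\mathcal P_{S,\delta}(\mathbb T)$ the matrices $\widetilde\Phi(\sigma(t),t)$, $t\in\mathbb S\cap\mathbb T_0^+$, exist and are unique, the function $\mathcal B=\widetilde{\mathcal L}[\widehat{\mathcal B}]$ is rd-continuous on $\mathbb T_0^+$, and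 $\mathcal A+\mathcal B$ is uniformly regressive. 2. $\widetilde{\mathcal L}$ is Lipschitz with constant $K$: for all $\widehat{\mathcal B}_1,\widehat{\mathcal B}_2\in\mathcal P_{S,\delta}(\mathbb T)$, $$\|\widetilde{\mathcal L}[\widehat{\mathcal B}_1]-\widetilde{\mathcal L}[\widehat{\mathcal B}_2]\|_\infty\le K\,\|\widehat{\mathcal B}_1-\widehat{\mathcal B}_2\|_\infty .$$ 3. $\widetilde{\mathcal L}$ is a left inverse of the map $\mathcal L[\mathcal B]=\widetilde{\mathcal A+\mathcal B}-\widetilde{\mathcal A}$: for every rd-continuous $\mathcal B$ on $\mathbb T_0^+$ with $\mathcal A+\mathcal B$ uniformly regressive, and every extension $\widetilde{\mathcal A+\mathcal B}$ of $\mathcal A+\mathcal B$, the matrices $\widetilde\Phi(\sigma(t),t)$, $t\in\mathbb S\cap\mathbb T_0^+$, for $\widehat{\mathcal B}=\mathcal L[\mathcal B]$ exist and are unique, and $\widetilde{\mathcal L}[\mathcal L[\mathcal B]]=\mathcal B$ on $\mathbb T_0^+$. -/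

import Mathlib

open scoped Matrix.Norms.L2Operator

namespace TimeScale

/- Matrices are complex `n × n` matrices with the operator norm of the Euclidean norm on `ℂⁿ`.
Matrix functions on `𝕋₀⁺ = 𝕋 ∩ [0, ∞)` or on `ℝ₊ = [0, ∞)` are functions on `ℝ` of which only the
values on that set are ever used. -/

/-- The forward jump operator `σ(t) = inf {s ∈ 𝕋 : s > t}`. -/
noncomputable def jump (T : Set ℝ) (t : ℝ) : ℝ := sInf {s | s ∈ T ∧ t < s}

/-- The graininess `μ(t) = σ(t) - t`. -/
noncomputable def graininess (T : Set ℝ) (t : ℝ) : ℝ := jump T t - t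

/-- The right-scattered points `𝕊` of the time scale. -/
def scattered (T : Set ℝ) : Set ℝ := {t | t ∈ T ∧ t < jump T t}

/-- The right-dense points `𝔻` of the time scale. -/
def dense (T : Set ℝ) : Set ℝ := {t | t ∈ T ∧ jump T t = t}

/-- A time scale: a closed set of reals that contains `0` and whose right-scattered points are
unbounded above (so that the set itself is unbounded above). -/
structure IsTimeScale (T : Set ℝ) : Prop where
  isClosed : IsClosed T
  zero_mem : (0 : ℝ) ∈ T
  unbounded_scattered : ¬ BddAbove (scattered T)

/-- The half-line `𝕋₀⁺ = 𝕋 ∩ [0, ∞)` of the time scale. -/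
def pos (T : Set ℝ) : Set ℝ := T ∩ Set.Ici 0

/-- The last point `[t]_𝕋 = sup (𝕋 ∩ (-∞, t])` of the time scale before `t`. -/
noncomputable def floor (T : Set ℝ) (t : ℝ) : ℝ := sSup (T ∩ Set.Iic t)

variable {n : ℕ}

/-- Rd-continuity on `𝕋₀⁺`: continuity at right-dense points, and finite left-sided limits at
left-dense points (the points of `𝕋₀⁺` that are limits of points of `𝕋₀⁺` from the left). -/
def RdContinuous (T : Set ℝ) (A : ℝ → Matrix (Fin n) (Fin n) ℂ) : Prop :=
  (∀ t ∈ dense T ∩ Set.Ici 0, ContinuousWithinAt A (pos T) t) ∧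
  (∀ t ∈ pos T, t ∈ closure (pos T ∩ Set.Iio t) →
    ∃ l, Filter.Tendsto A (nhdsWithin t (pos T ∩ Set.Iio t)) (nhds l))

/-- The sup norm of `F` on the set `s` is at most `c`. -/
def BoundedOn (s : Set ℝ) (F : ℝ → Matrix (Fin n) (Fin n) ℂ) (c : ℝ) : Prop :=
  ∀ t ∈ s, ‖F t‖ ≤ c

/-- The matrix `E + μ(t) A(t)`. -/
noncomputable def step (T : Set ℝ) (A : ℝ → Matrix (Fin n) (Fin n) ℂ) (t : ℝ) :
    Matrix (Fin n) (Fin n) ℂ :=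
  1 + (graininess T t : ℂ) • A t

/-- `E + μ A` is invertible on `𝕋₀⁺`, and its inverse has norm at most `ρ` there. -/
def UniformlyRegressiveWith (T : Set ℝ) (A : ℝ → Matrix (Fin n) (Fin n) ℂ) (ρ : ℝ) : Prop :=
  ∀ t ∈ pos T, IsUnit (step T A t) ∧ ‖(step T A t)⁻¹‖ ≤ ρ

/-- `A` is uniformly regressive on `𝕋₀⁺`. -/
def UniformlyRegressive (T : Set ℝ) (A : ℝ → Matrix (Fin n) (Fin n) ℂ) : Prop :=
  ∃ ρ, UniformlyRegressiveWith T A ρ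

/-- `A'` is an extension of `A` from `𝕋₀⁺` to `ℝ₊` by matrix logarithms: `A' = A` at right-dense
points, and `A'(t) = μ⁻¹ Log (E + μ A)`, taken at `[t]_𝕋`, at the other points `t ≥ 0`. A value of
the multivalued logarithm of `M` is any `X` with `exp X = M`; the branch is the same along
each gap `[t]_𝕋 ≤ t < σ([t]_𝕋)`. -/
structure IsExtension (T : Set ℝ) (A A' : ℝ → Matrix (Fin n) (Fin n) ℂ) : Prop where
  eq_of_dense : ∀ t, 0 ≤ t → t ∈ dense T → A' t = A t
  exp_eq : ∀ t, 0 ≤ t → t ∉ dense T →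
    NormedSpace.exp ((graininess T (floor T t) : ℂ) • A' t) = step T A (floor T t)
  const_on_gap : ∀ t, 0 ≤ t → t ∉ dense T → A' t = A' (floor T t)

/-- `M` is the value `Φ(t, s)`, `s ≤ t`, of the fundamental matrix of the linear system `x' = F x`:
`M = U(t)` for a solution of `U' = F U` on `[s, t]` with `U(s) = E`, where solutions are
understood through the integral equation, since `F` need not be continuous. -/
def IsTransition (F : ℝ → Matrix (Fin n) (Fin n) ℂ) (s t : ℝ)
    (M : Matrix (Fin n) (Fin n) ℂ) : Prop :=
  IntervalIntegrable F MeasureTheory.volume s t ∧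
  ∃ U : ℝ → Matrix (Fin n) (Fin n) ℂ, ContinuousOn U (Set.Icc s t) ∧
    (∀ r ∈ Set.Icc s t, U r = 1 + ∫ τ in s..r, F τ * U τ) ∧ U t = M

open Classical in
/-- The fundamental matrix `Φ(t, s)`, `s ≤ t`, of `x' = F x` (zero where it does not exist). -/
noncomputable def fundamental (F : ℝ → Matrix (Fin n) (Fin n) ℂ) (t s : ℝ) :
    Matrix (Fin n) (Fin n) ℂ :=
  if h : ∃ M, IsTransition F s t M then h.choose else 0

open Classical in
/-- The operator `B' ↦ B` from perturbations of the system `x' = A' x` to perturbations of the time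
scale system `x^Δ = A x`. -/
noncomputable def pullback (T : Set ℝ) (A A' B' : ℝ → Matrix (Fin n) (Fin n) ℂ) (t : ℝ) :
    Matrix (Fin n) (Fin n) ℂ :=
  if t ∈ dense T then B' t
  else (graininess T t : ℂ)⁻¹ • (fundamental (A' + B') (jump T t) t - 1) - A t

/-- The operator `pullback` is well defined at `B'`: all the values of the fundamental matrix that
occur in it exist and are unique. -/
def PullbackDefined (T : Set ℝ) (A' B' : ℝ → Matrix (Fin n) (Fin n) ℂ) : Prop :=
  ∀ t ∈ scattered T ∩ Set.Ici 0, ∃! M, IsTransition (A' + B') t (jump T t) M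

/-- Continuous perturbations on `ℝ₊` that are bounded by `δ` and vanish at distance more than `S`
from the time scale. -/
structure IsPerturbation (T : Set ℝ) (S δ : ℝ) (B' : ℝ → Matrix (Fin n) (Fin n) ℂ) : Prop where
  continuousOn : ContinuousOn B' (Set.Ici 0)
  bounded : BoundedOn (Set.Ici 0) B' δ
  vanish : ∀ t, 0 ≤ t → S < Metric.infDist t T → B' t = 0

end TimeScale

/-! On a gap `[t, σ(t))` the extension `A'` is a constant `X` with `exp (μ X) = E + μ A(t)`, and the
pullback `B` satisfies `E + μ (A + B)(t) = Φ(σ(t), t)`. Everything thus reduces to one linear ODE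
per gap. Solutions come from the Dyson series. Uniqueness, inverse bounds and Lipschitz dependence
all follow by pairing a solution `U` of `U' = f U` with a solution `V` of the adjoint equation `V' =
-V f`, which is the inverse of `U`. Rd-continuity: as `μ → 0`, `Φ - exp (μ X) = μ B' + o(μ)`, so the
pullback tends to `B'`. Uniformity over gaps of unbounded length: if `μ > 4S`, the perturbation
vanishes at distance `2S` or more from both ends, and `Φ = R (E + μ A) exp (-4S X) L` with `R`, `L`
transitions over length `2S` (`fundamental_long_gap`). The bound `ρ` then controls the inverse; for
the Lipschitz estimate the middle factor grows at most linearly in `μ`, which the division by `μ`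
absorbs. Left inverse: for `B' = C - A'` the coefficient is `C`, constant on each gap with
exponential `E + μ (A + B)`. -/

namespace TimeScale

open Set MeasureTheory intervalIntegral Topology


/-! ### Linear equations in a Banach space: the Dyson series -/

section LinearODE

variable {E : Type*} [NormedAddCommGroup E] [NormedSpace ℝ E]

/-- The terms of the Dyson series of the linear equation `x' = L x`, `x(s) = x₀`. -/
noncomputable def dyson (L : ℝ → E →L[ℝ] E) (s : ℝ) (x₀ : E) : ℕ → ℝ → E
  | 0 => fun _ => x₀
  | k + 1 => fun r => ∫ τ in s..r, L τ (dyson L s x₀ k τ)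

theorem continuous_dyson {L : ℝ → E →L[ℝ] E} (hL : Continuous L) (s : ℝ) (x₀ : E) (k : ℕ) :
    Continuous (dyson L s x₀ k) := by
  induction k with
  | zero => exact continuous_const
  | succ k ih =>
    exact intervalIntegral.continuous_primitive
      (fun a b => (hL.clm_apply ih).intervalIntegrable a b) s

/-- Integrating `c` times one bound gives exactly the next, so the bounds are the terms of an
exponential series. -/
theorem norm_dyson_le {L : ℝ → E →L[ℝ] E} {c : ℝ} (hc : ∀ r, ‖L r‖ ≤ c)
    (s : ℝ) (x₀ : E) (k : ℕ) {r : ℝ} (hr : s ≤ r) :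
    ‖dyson L s x₀ k r‖ ≤ ‖x₀‖ * ((c * (r - s)) ^ k / k.factorial) := by
  have hc0 : 0 ≤ c := (norm_nonneg _).trans (hc s)
  induction k generalizing r with
  | zero => simp [dyson]
  | succ k ih =>
    have hderiv : ∀ x ∈ uIcc s r, HasDerivAt
        (fun y => ‖x₀‖ * ((c * (y - s)) ^ (k + 1) / (k + 1).factorial))
        (c * (‖x₀‖ * ((c * (x - s)) ^ k / k.factorial))) x := by
      intro x _
      have h := ((((hasDerivAt_id x).sub_const s).const_mul c).pow (k + 1)).div_const
        ((k + 1).factorial : ℝ) |>.const_mul ‖x₀‖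
      refine h.congr_deriv ?_
      have : (k.factorial : ℝ) ≠ 0 := by positivity
      simp only [Nat.factorial_succ, id_eq, Nat.add_sub_cancel]
      push_cast
      field_simp
    have hint : ∫ x in s..r, c * (‖x₀‖ * ((c * (x - s)) ^ k / k.factorial)) =
        ‖x₀‖ * ((c * (r - s)) ^ (k + 1) / (k + 1).factorial) := by
      rw [integral_eq_sub_of_hasDerivAt hderiv (Continuous.intervalIntegrable (by fun_prop) _ _)]
      simp
    rw [← hint]
    refine norm_integral_le_of_norm_le hr ?_ (Continuous.intervalIntegrable (by fun_prop) _ _)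
    refine Filter.Eventually.of_forall fun x hx => ?_
    exact ((L x).le_opNorm _).trans
      (mul_le_mul (hc x) (ih hx.1.le) (norm_nonneg _) hc0)

/-- A continuous solution on `[s, t]` of the integral equation of `x' = L x` is the restriction of a
function that satisfies the differential equation on `[s, t]`, with two-sided derivatives. -/
theorem exists_hasDerivAt_of_integral_eq [CompleteSpace E] {L : ℝ → E →L[ℝ] E} (hL : Continuous L)
    {s t : ℝ} (hst : s ≤ t) {x₀ : E} {S : ℝ → E} (hScont : ContinuousOn S (Icc s t))
    (hSint : ∀ r ∈ Icc s t, S r = x₀ + ∫ τ in s..r, L τ (S τ)) :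
    ∃ u : ℝ → E, EqOn u S (Icc s t) ∧ ∀ r ∈ Icc s t, HasDerivAt u (L r (u r)) r := by
  -- Continuing `S` by constants makes the integrand continuous on the whole line, so the primitive
  -- has two-sided derivatives even at the endpoints.
  set V : ℝ → E := IccExtend hst ((Icc s t).domRestrict S) with hV
  have hVcont : Continuous V := hScont.domRestrict.Icc_extend'
  have hVS : ∀ r ∈ Icc s t, V r = S r := fun r hr => by
    rw [hV, IccExtend_of_mem _ _ hr]
    rfl
  have huS : ∀ r ∈ Icc s t, x₀ + ∫ τ in s..r, L τ (V τ) = S r := by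
    intro r hr
    rw [hSint r hr]
    congr 1
    refine integral_congr fun τ hτ => ?_
    rw [uIcc_of_le hr.1] at hτ
    simp only [hVS τ ⟨hτ.1, hτ.2.trans hr.2⟩]
  refine ⟨fun r => x₀ + ∫ τ in s..r, L τ (V τ), huS, fun r hr => ?_⟩
  have hcont : Continuous fun τ => L τ (V τ) := hL.clm_apply hVcont
  have h := (integral_hasDerivAt_right (hcont.intervalIntegrable s r)
    (hcont.stronglyMeasurableAtFilter _ _) hcont.continuousAt).const_add x₀
  simp only [huS r hr]
  rwa [hVS r hr] at h

/-- A linear equation with continuous bounded coefficients in a Banach space is solvable on every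
compact interval. -/
theorem exists_linear_ode [CompleteSpace E] {L : ℝ → E →L[ℝ] E} (hL : Continuous L) {c : ℝ}
    (hc : ∀ r, ‖L r‖ ≤ c) {s t : ℝ} (hst : s ≤ t) (x₀ : E) :
    ∃ u : ℝ → E, u s = x₀ ∧ (∀ r ∈ Icc s t, HasDerivAt u (L r (u r)) r) ∧
      ∀ r ∈ Icc s t, ‖u r‖ ≤ ‖x₀‖ * Real.exp (c * (r - s)) := by
  have hc0 : 0 ≤ c := (norm_nonneg _).trans (hc s)
  set b : ℕ → ℝ := fun k => ‖x₀‖ * ((c * (t - s)) ^ k / k.factorial) with hb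
  have hbs : Summable b := (Real.summable_pow_div_factorial _).mul_left _
  have hle : ∀ k, ∀ r ∈ Icc s t, ‖dyson L s x₀ k r‖ ≤ b k := by
    intro k r hr
    refine (norm_dyson_le hc s x₀ k hr.1).trans ?_
    have h1 : 0 ≤ r - s := sub_nonneg.2 hr.1
    have h2 := hr.2
    simp only [hb]
    gcongr
  set S : ℝ → E := fun r => ∑' k, dyson L s x₀ k r with hS
  have hScont : ContinuousOn S (Icc s t) :=
    continuousOn_tsum (fun k => (continuous_dyson hL s x₀ k).continuousOn) hbs hle
  have hsum : ∀ r ∈ Icc s t, HasSum (fun k => dyson L s x₀ k r) (S r) := fun r hr =>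
    (Summable.of_norm_bounded hbs fun k => hle k r hr).hasSum
  have hSbound : ∀ r ∈ Icc s t, ‖S r‖ ≤ ‖x₀‖ * Real.exp (c * (r - s)) := by
    intro r hr
    refine tsum_of_norm_bounded ?_ fun k => norm_dyson_le hc s x₀ k hr.1
    rw [Real.exp_eq_exp_ℝ]
    exact (NormedSpace.expSeries_div_hasSum_exp (c * (r - s))).mul_left _
  have hSint : ∀ r ∈ Icc s t, S r = x₀ + ∫ τ in s..r, L τ (S τ) := by
    intro r hr
    have h1 : HasSum (fun k => dyson L s x₀ (k + 1) r) (∫ τ in s..r, L τ (S τ)) := by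
      have hsub : ∀ τ ∈ uIoc s r, τ ∈ Icc s t := by
        intro τ hτ
        rw [uIoc_of_le hr.1] at hτ
        exact ⟨hτ.1.le, hτ.2.trans hr.2⟩
      refine hasSum_integral_of_dominated_convergence (fun k _ => c * b k) ?_ ?_ ?_ ?_ ?_
      · exact fun k =>
          (hL.clm_apply (continuous_dyson hL s x₀ k)).aestronglyMeasurable
      · refine fun k => Filter.Eventually.of_forall fun τ hτ => ?_
        exact ((L τ).le_opNorm _).trans
          (mul_le_mul (hc τ) (hle k τ (hsub τ hτ)) (norm_nonneg _) hc0)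
      · exact Filter.Eventually.of_forall fun τ _ => hbs.mul_left c
      · exact intervalIntegrable_const
      · exact Filter.Eventually.of_forall fun τ hτ => (L τ).hasSum (hsum τ (hsub τ hτ))
    -- Integrating the series shifts its index by one; the missing zeroth term is `x₀`.
    have h2 := (hsum r hr).unique ((hasSum_nat_add_iff (f := fun k => dyson L s x₀ k r) 1).1 h1)
    rw [h2, Finset.sum_range_one, add_comm]
    rfl
  obtain ⟨u, huS, hu⟩ := exists_hasDerivAt_of_integral_eq hL hst hScont hSint
  refine ⟨u, ?_, hu, fun r hr => (huS hr).symm ▸ hSbound r hr⟩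
  rw [huS (left_mem_Icc.2 hst), hSint s (left_mem_Icc.2 hst)]
  simp

end LinearODE


/-! ### Solutions and adjoint solutions in a Banach algebra -/

section BanachAlgebra

variable {R : Type*} [NormedRing R] [NormedAlgebra ℝ R]

theorem exists_left_solution [CompleteSpace R] {f : ℝ → R} (hf : Continuous f) {c : ℝ}
    (hc : ∀ r, ‖f r‖ ≤ c) (h1 : ‖(1 : R)‖ ≤ 1) {s t : ℝ} (hst : s ≤ t) :
    ∃ U : ℝ → R, U s = 1 ∧ (∀ r ∈ Icc s t, HasDerivAt U (f r * U r) r) ∧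
      ∀ r ∈ Icc s t, ‖U r‖ ≤ Real.exp (c * (r - s)) := by
  obtain ⟨u, hu, hd, hb⟩ := exists_linear_ode (L := fun r => ContinuousLinearMap.mul ℝ R (f r))
    (by fun_prop) (fun r => (ContinuousLinearMap.opNorm_mul_apply_le ℝ R (f r)).trans (hc r))
    hst (1 : R)
  exact ⟨u, hu, hd, fun r hr =>
    (hb r hr).trans (mul_le_of_le_one_left (Real.exp_pos _).le h1)⟩

/-- The adjoint solution serves as the inverse of the left solution, obtained with its own
exponential bound. -/
theorem exists_right_solution [CompleteSpace R] {f : ℝ → R} (hf : Continuous f) {c : ℝ}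
    (hc : ∀ r, ‖f r‖ ≤ c) (h1 : ‖(1 : R)‖ ≤ 1) {s t : ℝ} (hst : s ≤ t) :
    ∃ V : ℝ → R, V s = 1 ∧ (∀ r ∈ Icc s t, HasDerivAt V (-(V r * f r)) r) ∧
      ∀ r ∈ Icc s t, ‖V r‖ ≤ Real.exp (c * (r - s)) := by
  obtain ⟨u, hu, hd, hb⟩ := exists_linear_ode
    (L := fun r => -(ContinuousLinearMap.mul ℝ R).flip (f r)) (c := c) (by fun_prop)
    (fun r => by
      rw [norm_neg]
      refine ContinuousLinearMap.opNorm_le_bound _ ((norm_nonneg _).trans (hc r)) fun x => ?_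
      simp only [ContinuousLinearMap.flip_apply, ContinuousLinearMap.mul_apply']
      rw [mul_comm c]
      exact (norm_mul_le _ _).trans (mul_le_mul_of_nonneg_left (hc r) (norm_nonneg _)))
    hst (1 : R)
  exact ⟨u, hu, hd, fun r hr =>
    (hb r hr).trans (mul_le_of_le_one_left (Real.exp_pos _).le h1)⟩

/-- If `U` solves `U' = f U` and `V` solves the adjoint equation `V' = - V g`, then `V U` varies at
a rate controlled by `f - g`. -/
theorem norm_mul_sub_mul_le {f g U V : ℝ → R} {s t C : ℝ} (hst : s ≤ t)
    (hU : ∀ r ∈ Icc s t, HasDerivAt U (f r * U r) r)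
    (hV : ∀ r ∈ Icc s t, HasDerivAt V (-(V r * g r)) r)
    (hC : ∀ r ∈ Icc s t, ‖V r * (f r - g r) * U r‖ ≤ C) :
    ‖V t * U t - V s * U s‖ ≤ C * (t - s) := by
  refine norm_image_sub_le_of_norm_deriv_le_segment' (f := fun r => V r * U r)
    (fun r hr => ((hV r hr).mul (hU r hr)).hasDerivWithinAt) (fun r hr => ?_) t ⟨hst, le_rfl⟩
  refine le_of_eq_of_le ?_ (hC r ⟨hr.1, hr.2.le⟩)
  congr 1
  noncomm_ring

theorem mul_eq_mul_of_adjoint {f U V : ℝ → R} {s t : ℝ} (hst : s ≤ t)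
    (hU : ∀ r ∈ Icc s t, HasDerivAt U (f r * U r) r)
    (hV : ∀ r ∈ Icc s t, HasDerivAt V (-(V r * f r)) r) : V t * U t = V s * U s := by
  have h := norm_mul_sub_mul_le (C := 0) hst hU hV (fun r _ => by simp)
  rw [zero_mul] at h
  exact sub_eq_zero.1 (norm_le_zero_iff.1 h)

end BanachAlgebra

/-! ### Transition matrices: uniqueness, estimates, expansions -/

section Transition

variable {n : ℕ}

/-- Only an inequality, because the norm of the identity is `0` when `n = 0`. -/
theorem norm_one_le_one : ‖(1 : Matrix (Fin n) (Fin n) ℂ)‖ ≤ 1 := by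
  rw [← Matrix.diagonal_one, Matrix.l2_opNorm_diagonal]
  exact (pi_norm_le_iff_of_nonneg zero_le_one).2 fun i => by simp

/-- The value of a transition matrix only depends on the coefficients off the right endpoint. -/
theorem IsTransition.congr {F G : ℝ → Matrix (Fin n) (Fin n) ℂ} {s t : ℝ} (hst : s ≤ t)
    {M : Matrix (Fin n) (Fin n) ℂ} (hFG : EqOn F G (Ico s t)) (h : IsTransition F s t M) :
    IsTransition G s t M := by
  have hne : ∀ᵐ τ : ℝ, τ ≠ t := by simp [ae_iff]
  obtain ⟨hi, U, hU, hint, hM⟩ := h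
  refine ⟨?_, U, hU, fun r hr => ?_, hM⟩
  · refine hi.congr_ae ((ae_restrict_iff' measurableSet_uIoc).2 ?_)
    filter_upwards [hne] with τ hτ hm
    rw [uIoc_of_le hst] at hm
    exact hFG ⟨hm.1.le, lt_of_le_of_ne hm.2 hτ⟩
  · rw [hint r hr]
    congr 1
    refine integral_congr_ae ?_
    filter_upwards [hne] with τ hτ hm
    rw [uIoc_of_le hr.1] at hm
    rw [hFG ⟨hm.1.le, lt_of_le_of_ne (hm.2.trans hr.2) hτ⟩]

theorem isTransition_iff {f : ℝ → Matrix (Fin n) (Fin n) ℂ} (hf : Continuous f) {s t : ℝ}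
    (hst : s ≤ t) {M : Matrix (Fin n) (Fin n) ℂ} :
    IsTransition f s t M ↔ ∃ U : ℝ → Matrix (Fin n) (Fin n) ℂ, U s = 1 ∧
      (∀ r ∈ Icc s t, HasDerivAt U (f r * U r) r) ∧ U t = M := by
  constructor
  · rintro ⟨-, U, hU, hint, hM⟩
    obtain ⟨u, huU, hu⟩ := exists_hasDerivAt_of_integral_eq
      (L := fun r => ContinuousLinearMap.mul ℝ (Matrix (Fin n) (Fin n) ℂ) (f r))
      (by fun_prop) hst hU hint
    refine ⟨u, ?_, hu, ?_⟩
    · rw [huU (left_mem_Icc.2 hst), hint s (left_mem_Icc.2 hst)]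
      simp
    · rw [huU (right_mem_Icc.2 hst), hM]
  · rintro ⟨U, h1, hd, hM⟩
    have hUc : ContinuousOn U (Icc s t) := fun r hr => (hd r hr).continuousAt.continuousWithinAt
    refine ⟨hf.intervalIntegrable _ _, U, hUc, fun r hr => ?_, hM⟩
    have hsub : uIcc s r ⊆ Icc s t := by
      rw [uIcc_of_le hr.1]
      exact Icc_subset_Icc_right hr.2
    rw [integral_eq_sub_of_hasDerivAt (fun τ hτ => hd τ (hsub hτ))
      ((hf.continuousOn.mul (hUc.mono hsub)).intervalIntegrable), h1]
    abel

/-- Any solution `W` has `V W` constant, equal to `1`, so `W t` is the inverse of the fixed matrix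
`V t`; no Gronwall argument is needed. -/
theorem existsUnique_isTransition {f : ℝ → Matrix (Fin n) (Fin n) ℂ} (hf : Continuous f) {c : ℝ}
    (hc : ∀ r, ‖f r‖ ≤ c) {s t : ℝ} (hst : s ≤ t) : ∃! M, IsTransition f s t M := by
  obtain ⟨U, hU1, hU, -⟩ := exists_left_solution hf hc norm_one_le_one hst
  obtain ⟨V, hV1, hV, -⟩ := exists_right_solution hf hc norm_one_le_one hst
  refine ⟨U t, (isTransition_iff hf hst).2 ⟨U, hU1, hU, rfl⟩, fun M hM => ?_⟩
  obtain ⟨W, hW1, hW, rfl⟩ := (isTransition_iff hf hst).1 hM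
  have h1 := mul_eq_mul_of_adjoint hst hU hV
  have h2 := mul_eq_mul_of_adjoint hst hW hV
  rw [hU1, hV1, mul_one] at h1
  rw [hW1, hV1, mul_one] at h2
  rw [← one_mul (W t), ← mul_eq_one_comm.1 h1, mul_assoc, h2, mul_one]

theorem fundamental_eq {F : ℝ → Matrix (Fin n) (Fin n) ℂ} {s t : ℝ}
    (h : ∃! M, IsTransition F s t M) {M : Matrix (Fin n) (Fin n) ℂ} (hM : IsTransition F s t M) :
    fundamental F t s = M := by
  have hex : ∃ M, IsTransition F s t M := ⟨M, hM⟩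
  rw [fundamental, dif_pos hex]
  exact h.unique hex.choose_spec hM

theorem fundamental_eq_of_hasDerivAt {f : ℝ → Matrix (Fin n) (Fin n) ℂ} (hf : Continuous f) {c : ℝ}
    (hc : ∀ r, ‖f r‖ ≤ c) {s t : ℝ} (hst : s ≤ t) {U : ℝ → Matrix (Fin n) (Fin n) ℂ}
    (h1 : U s = 1) (hU : ∀ r ∈ Icc s t, HasDerivAt U (f r * U r) r) : fundamental f t s = U t :=
  fundamental_eq (existsUnique_isTransition hf hc hst) ((isTransition_iff hf hst).2 ⟨U, h1, hU, rfl⟩)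

theorem norm_fundamental_le {f : ℝ → Matrix (Fin n) (Fin n) ℂ} (hf : Continuous f) {c : ℝ}
    (hc : ∀ r, ‖f r‖ ≤ c) {s t : ℝ} (hst : s ≤ t) :
    ‖fundamental f t s‖ ≤ Real.exp (c * (t - s)) := by
  obtain ⟨U, hU1, hU, hb⟩ := exists_left_solution hf hc norm_one_le_one hst
  rw [fundamental_eq_of_hasDerivAt hf hc hst hU1 hU]
  exact hb t ⟨hst, le_rfl⟩

theorem fundamental_inverse {f : ℝ → Matrix (Fin n) (Fin n) ℂ} (hf : Continuous f) {c : ℝ}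
    (hc : ∀ r, ‖f r‖ ≤ c) {s t : ℝ} (hst : s ≤ t) :
    IsUnit (fundamental f t s) ∧ ‖(fundamental f t s)⁻¹‖ ≤ Real.exp (c * (t - s)) := by
  obtain ⟨U, hU1, hU, -⟩ := exists_left_solution hf hc norm_one_le_one hst
  obtain ⟨V, hV1, hV, hb⟩ := exists_right_solution hf hc norm_one_le_one hst
  rw [fundamental_eq_of_hasDerivAt hf hc hst hU1 hU]
  have h := mul_eq_mul_of_adjoint hst hU hV
  rw [hU1, hV1, mul_one] at h
  refine ⟨.of_mul_eq_one _ (mul_eq_one_comm.1 h), ?_⟩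
  rw [Matrix.inv_eq_left_inv h]
  exact hb t ⟨hst, le_rfl⟩

theorem fundamental_mul {f : ℝ → Matrix (Fin n) (Fin n) ℂ} (hf : Continuous f) {c : ℝ}
    (hc : ∀ r, ‖f r‖ ≤ c) {s p t : ℝ} (hsp : s ≤ p) (hpt : p ≤ t) :
    fundamental f t p * fundamental f p s = fundamental f t s := by
  obtain ⟨U, hU1, hU, -⟩ := exists_left_solution hf hc norm_one_le_one (hsp.trans hpt)
  obtain ⟨W, hW1, hW, -⟩ := exists_left_solution hf hc norm_one_le_one hpt
  obtain ⟨V, hV1, hV, -⟩ := exists_right_solution hf hc norm_one_le_one hpt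
  rw [fundamental_eq_of_hasDerivAt hf hc (hsp.trans hpt) hU1 hU,
    fundamental_eq_of_hasDerivAt hf hc hsp hU1 fun r hr => hU r ⟨hr.1, hr.2.trans hpt⟩,
    fundamental_eq_of_hasDerivAt hf hc hpt hW1 hW]
  have h1 := mul_eq_mul_of_adjoint hpt (fun r hr => hU r ⟨hsp.trans hr.1, hr.2⟩) hV
  have h2 := mul_eq_mul_of_adjoint hpt hW hV
  rw [hV1, one_mul] at h1
  rw [hW1, hV1, mul_one] at h2
  rw [← h1, ← mul_assoc, mul_eq_one_comm.1 h2, one_mul]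

/-- The fundamental matrix depends on the coefficients in a Lipschitz continuous way. -/
theorem norm_fundamental_sub_le {f g : ℝ → Matrix (Fin n) (Fin n) ℂ} (hf : Continuous f)
    (hg : Continuous g) {c ε : ℝ} (hcf : ∀ r, ‖f r‖ ≤ c) (hcg : ∀ r, ‖g r‖ ≤ c) {s t : ℝ}
    (hst : s ≤ t) (hε : ∀ r ∈ Icc s t, ‖f r - g r‖ ≤ ε) :
    ‖fundamental f t s - fundamental g t s‖ ≤ Real.exp (c * (t - s)) ^ 3 * (t - s) * ε := by
  have hc0 : 0 ≤ c := (norm_nonneg _).trans (hcf s)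
  obtain ⟨U, hU1, hU, hUb⟩ := exists_left_solution hf hcf norm_one_le_one hst
  obtain ⟨W, hW1, hW, hWb⟩ := exists_left_solution hg hcg norm_one_le_one hst
  obtain ⟨V, hV1, hV, hVb⟩ := exists_right_solution hg hcg norm_one_le_one hst
  have ht : t ∈ Icc s t := ⟨hst, le_rfl⟩
  rw [fundamental_eq_of_hasDerivAt hf hcf hst hU1 hU, fundamental_eq_of_hasDerivAt hg hcg hst hW1 hW]
  set e := Real.exp (c * (t - s)) with he
  have hle : ∀ r ∈ Icc s t, Real.exp (c * (r - s)) ≤ e := fun r hr => by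
    have := hr.2
    rw [he]
    gcongr
  have h1 : ‖V t * U t - V s * U s‖ ≤ e * ε * e * (t - s) := by
    refine norm_mul_sub_mul_le hst hU hV fun r hr => ?_
    refine (norm_mul_le _ _).trans (mul_le_mul ((norm_mul_le _ _).trans ?_)
      ((hUb r hr).trans (hle r hr)) (norm_nonneg _)
      (mul_nonneg (Real.exp_pos _).le ((norm_nonneg _).trans (hε r hr))))
    exact mul_le_mul ((hVb r hr).trans (hle r hr)) (hε r hr) (norm_nonneg _) (Real.exp_pos _).le
  have h2 := mul_eq_mul_of_adjoint hst hW hV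
  rw [hW1, hV1, mul_one] at h2
  rw [hU1, hV1, mul_one] at h1
  -- Since `W` inverts `V`, the difference is `W (V U - 1)`. The three factors `W`, `V`, `U` account
  -- for the cube of the exponential.
  have h3 : U t - W t = W t * (V t * U t - 1) := by
    rw [mul_sub, ← mul_assoc, mul_eq_one_comm.1 h2, one_mul, mul_one]
  rw [h3]
  refine (norm_mul_le _ _).trans ((mul_le_mul (hWb t ht) h1 (norm_nonneg _)
    (Real.exp_pos _).le).trans (le_of_eq ?_))
  ring

/-- The first order expansion of the fundamental matrix, with quadratic remainder. -/
theorem norm_fundamental_sub_one_sub_integral_le {f : ℝ → Matrix (Fin n) (Fin n) ℂ}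
    (hf : Continuous f) {c : ℝ} (hc : ∀ r, ‖f r‖ ≤ c) {s t : ℝ} (hst : s ≤ t) :
    ‖fundamental f t s - 1 - ∫ τ in s..t, f τ‖ ≤
      c ^ 2 * Real.exp (c * (t - s)) * (t - s) ^ 2 := by
  have hc0 : 0 ≤ c := (norm_nonneg _).trans (hc s)
  obtain ⟨U, hU1, hU, hUb⟩ := exists_left_solution hf hc norm_one_le_one hst
  rw [fundamental_eq_of_hasDerivAt hf hc hst hU1 hU]
  set e := Real.exp (c * (t - s)) with he
  have hle : ∀ r ∈ Icc s t, ‖U r‖ ≤ e := fun r hr => by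
    refine (hUb r hr).trans ?_
    have := hr.2
    rw [he]
    gcongr
  have h1 : ∀ r ∈ Icc s t, ‖U r - 1‖ ≤ c * e * (t - s) := fun r hr => by
    rw [← hU1]
    refine (norm_image_sub_le_of_norm_deriv_le_segment'
      (fun x hx => (hU x hx).hasDerivWithinAt) (fun x hx => ?_) r hr).trans
      (mul_le_mul_of_nonneg_left (sub_le_sub_right hr.2 s) (mul_nonneg hc0 (Real.exp_pos _).le))
    exact (norm_mul_le _ _).trans
      (mul_le_mul (hc x) (hle x ⟨hx.1, hx.2.le⟩) (norm_nonneg _) hc0)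
  -- The remainder has derivative `f (U - 1)`, and `U - 1` is already of first order: a second use
  -- of the mean value inequality gives the quadratic bound.
  have hd : ∀ r ∈ Icc s t, HasDerivAt (fun r => U r - 1 - ∫ τ in s..r, f τ)
      (f r * (U r - 1)) r := fun r hr => by
    refine (((hU r hr).sub_const 1).sub (integral_hasDerivAt_right (hf.intervalIntegrable s r)
      (hf.stronglyMeasurableAtFilter _ _) hf.continuousAt)).congr_deriv ?_
    rw [mul_sub, mul_one]
  have h2 := norm_image_sub_le_of_norm_deriv_le_segment'
    (fun r hr => (hd r hr).hasDerivWithinAt) (C := c * (c * e * (t - s))) (fun r hr =>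
      (norm_mul_le _ _).trans (mul_le_mul (hc r) (h1 r ⟨hr.1, hr.2.le⟩) (norm_nonneg _) hc0))
    t ⟨hst, le_rfl⟩
  simp only [hU1, sub_self, integral_same, sub_zero] at h2
  refine h2.trans (le_of_eq ?_)
  ring

theorem fundamental_of_const {f : ℝ → Matrix (Fin n) (Fin n) ℂ} (hf : Continuous f) {c : ℝ}
    (hc : ∀ r, ‖f r‖ ≤ c) {s t : ℝ} (hst : s ≤ t) {X : Matrix (Fin n) (Fin n) ℂ}
    (hX : ∀ r ∈ Icc s t, f r = X) : fundamental f t s = NormedSpace.exp ((t - s) • X) := by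
  refine fundamental_eq_of_hasDerivAt (U := fun r => NormedSpace.exp ((r - s) • X)) hf hc hst
    (by simp) fun r hr => ?_
  rw [hX r hr]
  have h := (hasDerivAt_exp_smul_const' (𝕂 := ℝ) X (r - s)).scomp r ((hasDerivAt_id r).sub_const s)
  exact h.congr_deriv (one_smul _ _)

theorem norm_exp_smul_le (X : Matrix (Fin n) (Fin n) ℂ) {r : ℝ} (hr : 0 ≤ r) :
    ‖NormedSpace.exp (r • X)‖ ≤ Real.exp (‖X‖ * r) := by
  have h := norm_fundamental_le (continuous_const (y := X)) (fun _ => le_rfl) hr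
  rwa [fundamental_of_const (continuous_const (y := X)) (fun _ => le_rfl) hr fun _ _ => rfl,
    sub_zero] at h

theorem exp_smul_neg_mul_exp_smul (X : Matrix (Fin n) (Fin n) ℂ) (r : ℝ) :
    NormedSpace.exp (r • -X) * NormedSpace.exp (r • X) = 1 := by
  rw [← Matrix.exp_add_of_commute _ _ (((Commute.refl X).neg_left.smul_left r).smul_right r)]
  simp

/-- If the coefficients are constant on `[p, q]`, the fundamental matrix over `[s, t]` is expressed
through the exponential over the whole interval. -/
theorem fundamental_eq_mul_exp_mul {f : ℝ → Matrix (Fin n) (Fin n) ℂ} (hf : Continuous f) {c : ℝ}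
    (hc : ∀ r, ‖f r‖ ≤ c) {s p q t : ℝ} (hsp : s ≤ p) (hpq : p ≤ q) (hqt : q ≤ t)
    {X : Matrix (Fin n) (Fin n) ℂ} (hX : ∀ r ∈ Icc p q, f r = X) :
    fundamental f t s = fundamental f t q *
      (NormedSpace.exp ((t - s) • X) * NormedSpace.exp ((t - q + (p - s)) • -X)) *
        fundamental f p s := by
  -- The middle factor `exp ((q - p) X)` splits into the exponential over the whole interval and a
  -- correction depending only on the lengths of the end pieces.
  rw [← fundamental_mul hf hc hsp (hpq.trans hqt), ← fundamental_mul hf hc hpq hqt,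
    fundamental_of_const hf hc hpq hX, ← Matrix.exp_add_of_commute _ _
      (((Commute.refl X).neg_right.smul_left _).smul_right _)]
  congr 4
  module

/-- Both transition matrices are expanded to first order: the linear terms leave the integral of `f
- X - Y`, and the two quadratic remainders give the factor `2`. -/
theorem norm_fundamental_sub_exp_sub_smul_le {f : ℝ → Matrix (Fin n) (Fin n) ℂ}
    (hf : Continuous f) {c ε : ℝ} (hc : ∀ r, ‖f r‖ ≤ c) {s t : ℝ} (hst : s ≤ t)
    {X Y : Matrix (Fin n) (Fin n) ℂ} (hX : ‖X‖ ≤ c) (hY : ∀ r ∈ Icc s t, ‖f r - X - Y‖ ≤ ε) :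
    ‖fundamental f t s - NormedSpace.exp ((t - s) • X) - (t - s) • Y‖ ≤
      (ε + 2 * c ^ 2 * Real.exp (c * (t - s)) * (t - s)) * (t - s) := by
  have h1 := norm_fundamental_sub_one_sub_integral_le hf hc hst
  have h2 := norm_fundamental_sub_one_sub_integral_le (continuous_const (y := X)) (fun _ => hX) hst
  rw [fundamental_of_const (continuous_const (y := X)) (fun _ => hX) hst fun _ _ => rfl,
    intervalIntegral.integral_const] at h2
  have h3 : ‖∫ τ in s..t, (f τ - X - Y)‖ ≤ ε * (t - s) := by
    rw [← abs_of_nonneg (sub_nonneg.2 hst)]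
    refine norm_integral_le_of_norm_le_const fun r hr => hY r ?_
    rw [uIoc_of_le hst] at hr
    exact ⟨hr.1.le, hr.2⟩
  have h4 : ∫ τ in s..t, (f τ - X - Y) = (∫ τ in s..t, f τ) - (t - s) • X - (t - s) • Y := by
    have hfX : Continuous fun τ => f τ - X := hf.sub continuous_const
    rw [intervalIntegral.integral_sub (hfX.intervalIntegrable _ _)
      (continuous_const.intervalIntegrable _ _), intervalIntegral.integral_sub
      (hf.intervalIntegrable _ _) (continuous_const.intervalIntegrable _ _),
      intervalIntegral.integral_const, intervalIntegral.integral_const]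
  have h5 : fundamental f t s - NormedSpace.exp ((t - s) • X) - (t - s) • Y =
      (fundamental f t s - 1 - ∫ τ in s..t, f τ) -
        (NormedSpace.exp ((t - s) • X) - 1 - (t - s) • X) + ∫ τ in s..t, (f τ - X - Y) := by
    rw [h4]
    abel
  rw [h5]
  refine (norm_add_le _ _).trans ((add_le_add ((norm_sub_le _ _).trans (add_le_add h1 h2)) h3).trans
    (le_of_eq ?_))
  ring

end Transition


/-! ### Jumps, gaps and graininess -/

section Points

variable {T : Set ℝ}

theorem IsTimeScale.exists_gt (hT : IsTimeScale T) (t : ℝ) : {s | s ∈ T ∧ t < s}.Nonempty := by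
  obtain ⟨s, hs, hts⟩ := not_bddAbove_iff.1 hT.unbounded_scattered t
  exact ⟨s, hs.1, hts⟩

theorem jump_le {s t : ℝ} (hs : s ∈ T) (hts : t < s) : jump T t ≤ s :=
  csInf_le ⟨t, fun _ h => h.2.le⟩ ⟨hs, hts⟩

theorem IsTimeScale.le_jump (hT : IsTimeScale T) (t : ℝ) : t ≤ jump T t :=
  le_csInf (hT.exists_gt t) fun _ h => h.2.le

theorem IsTimeScale.graininess_nonneg (hT : IsTimeScale T) (t : ℝ) : 0 ≤ graininess T t :=
  sub_nonneg.2 (hT.le_jump t)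

theorem IsTimeScale.lt_jump (hT : IsTimeScale T) {t : ℝ} (ht : t ∈ T) (hd : t ∉ dense T) :
    t < jump T t :=
  lt_of_le_of_ne (hT.le_jump t) fun h => hd ⟨ht, h.symm⟩

theorem graininess_of_dense {t : ℝ} (ht : t ∈ dense T) : graininess T t = 0 :=
  sub_eq_zero.2 ht.2

theorem notMem_of_mem_gap {t r : ℝ} (hr : t < r) (hrj : r < jump T t) : r ∉ T :=
  fun h => (jump_le h hr).not_gt hrj

theorem floor_of_mem_gap {t r : ℝ} (ht : t ∈ T) (hr : r ∈ Ico t (jump T t)) : floor T r = t := by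
  refine IsGreatest.csSup_eq ⟨⟨ht, hr.1⟩, fun x hx => ?_⟩
  by_contra! h
  exact notMem_of_mem_gap h (lt_of_le_of_lt hx.2 hr.2) hx.1

theorem notMem_dense_of_mem_gap {t r : ℝ} (hr : r ∈ Ico t (jump T t)) : r ∉ dense T := by
  intro h
  rcases hr.1.eq_or_lt with rfl | hlt
  · exact hr.2.ne' h.2
  · exact notMem_of_mem_gap hlt hr.2 h.1

theorem le_infDist_of_mem_gap (hT : IsTimeScale T) {t r d : ℝ} (h1 : t + d ≤ r)
    (h2 : r ≤ jump T t - d) : d ≤ Metric.infDist r T := by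
  refine (Metric.le_infDist ⟨0, hT.zero_mem⟩).2 fun x hx => ?_
  rw [Real.dist_eq]
  rcases le_or_gt x t with h | h
  · exact (by linarith : d ≤ r - x).trans (le_abs_self _)
  · have := jump_le hx h
    exact (by linarith : d ≤ -(r - x)).trans (neg_le_abs _)

theorem graininess_le_of_lt {s t : ℝ} (ht : t ∈ T) (hst : s < t) : graininess T s ≤ t - s :=
  sub_le_sub_right (jump_le ht hst) s

theorem IsTimeScale.tendsto_graininess_left (hT : IsTimeScale T) {t : ℝ} (ht : t ∈ T) :
    Filter.Tendsto (graininess T) (𝓝[<] t) (𝓝 0) := by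
  have h : Filter.Tendsto (fun s => t - s) (𝓝[<] t) (𝓝 0) := by
    have : Filter.Tendsto (fun s => t - s) (𝓝 t) (𝓝 (t - t)) :=
      (continuous_const.sub continuous_id).tendsto t
    rw [sub_self] at this
    exact this.mono_left nhdsWithin_le_nhds
  refine tendsto_of_tendsto_of_tendsto_of_le_of_le' tendsto_const_nhds h
    (Filter.Eventually.of_forall hT.graininess_nonneg) ?_
  filter_upwards [self_mem_nhdsWithin] with s hs
  exact graininess_le_of_lt ht hs

/-- On the right, density gives points `p` of `T` arbitrarily close to `t`, and `μ(s) ≤ p - s` for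
`s` in `[t, p)`. -/
theorem IsTimeScale.tendsto_graininess_of_dense (hT : IsTimeScale T) {t : ℝ} (ht : t ∈ dense T) :
    Filter.Tendsto (graininess T) (𝓝 t) (𝓝 0) := by
  rw [← nhdsLT_sup_nhdsGE]
  refine (hT.tendsto_graininess_left ht.1).sup ?_
  refine Metric.tendsto_nhds.2 fun ε hε => ?_
  obtain ⟨p, hp, hpε⟩ := exists_lt_of_csInf_lt (hT.exists_gt t)
    (show jump T t < t + ε by rw [ht.2]; linarith)
  filter_upwards [Ico_mem_nhdsGE hp.2] with s hs
  rw [Real.dist_0_eq_abs, abs_of_nonneg (hT.graininess_nonneg s)]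
  have := graininess_le_of_lt hp.1 hs.2
  linarith [hs.1]

end Points

/-! ### The equation on a single gap, and rd-continuity -/

section Gap

variable {n : ℕ} {T : Set ℝ} {A A' B' : ℝ → Matrix (Fin n) (Fin n) ℂ}

theorem IsExtension.eqOn_gap (h : IsExtension T A A') {t : ℝ} (ht : t ∈ pos T) :
    EqOn A' (fun _ => A' t) (Ico t (jump T t)) := fun r hr => by
  rw [h.const_on_gap r (ht.2.trans hr.1) (notMem_dense_of_mem_gap hr), floor_of_mem_gap ht.1 hr]

theorem IsExtension.exp_smul_eq (h : IsExtension T A A') {t : ℝ} (ht : t ∈ pos T)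
    (htj : t < jump T t) : NormedSpace.exp ((jump T t - t) • A' t) = step T A t := by
  have hm : t ∈ Ico t (jump T t) := ⟨le_rfl, htj⟩
  have h1 := h.exp_eq t ht.2 (notMem_dense_of_mem_gap hm)
  rw [floor_of_mem_gap ht.1 hm, Complex.coe_smul] at h1
  exact h1

/-- On a gap of the time scale, a continuous function with the values of `A' + B'`, continued by
constants to the real line. -/
noncomputable def gapCoeff (T : Set ℝ) (A' B' : ℝ → Matrix (Fin n) (Fin n) ℂ) (t r : ℝ) :
    Matrix (Fin n) (Fin n) ℂ :=
  A' t + B' (max t (min (jump T t) r))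

theorem gapCoeff_of_mem {t r : ℝ} (hr : r ∈ Icc t (jump T t)) :
    gapCoeff T A' B' t r = A' t + B' r := by
  rw [gapCoeff, min_eq_right hr.2, max_eq_right hr.1]

theorem continuous_gapCoeff {t : ℝ} (ht : 0 ≤ t) (hB : ContinuousOn B' (Ici 0)) :
    Continuous (gapCoeff T A' B' t) :=
  continuous_const.add (hB.comp_continuous (by fun_prop) fun _ => ht.trans (le_max_left _ _))

theorem norm_gapCoeff_le {α δ : ℝ} (hα : BoundedOn (Ici 0) A' α) (hδ : BoundedOn (Ici 0) B' δ)
    {t : ℝ} (ht : 0 ≤ t) (r : ℝ) : ‖gapCoeff T A' B' t r‖ ≤ α + δ :=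
  (norm_add_le _ _).trans (add_le_add (hα t ht) (hδ _ (ht.trans (le_max_left _ _))))

/-- `A'` is constant only on the half-open gap, but the value at the single point `σ(t)` does not
affect the integral equation. Hence `A' + B'` may be replaced by a continuous coefficient. -/
theorem IsExtension.isTransition_gap_iff (h : IsExtension T A A') {t : ℝ} (ht : t ∈ pos T)
    (htj : t < jump T t) {M : Matrix (Fin n) (Fin n) ℂ} :
    IsTransition (A' + B') t (jump T t) M ↔ IsTransition (gapCoeff T A' B' t) t (jump T t) M := by
  have heq : EqOn (A' + B') (gapCoeff T A' B' t) (Ico t (jump T t)) := fun r hr => by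
    rw [gapCoeff_of_mem ⟨hr.1, hr.2.le⟩, Pi.add_apply, h.eqOn_gap ht hr]
  exact ⟨.congr htj.le heq, .congr htj.le heq.symm⟩

theorem IsExtension.existsUnique_isTransition (h : IsExtension T A A') {α δ : ℝ}
    (hα : BoundedOn (Ici 0) A' α) (hB : ContinuousOn B' (Ici 0)) (hδ : BoundedOn (Ici 0) B' δ)
    {t : ℝ} (ht : t ∈ pos T) (htj : t < jump T t) :
    ∃! M, IsTransition (A' + B') t (jump T t) M := by
  simp only [h.isTransition_gap_iff ht htj]
  exact TimeScale.existsUnique_isTransition (continuous_gapCoeff ht.2 hB)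
    (norm_gapCoeff_le hα hδ ht.2) htj.le

theorem IsExtension.fundamental_gap (h : IsExtension T A A') {t : ℝ} (ht : t ∈ pos T)
    (htj : t < jump T t) :
    fundamental (A' + B') (jump T t) t = fundamental (gapCoeff T A' B' t) (jump T t) t := by
  have hfun : IsTransition (A' + B') t (jump T t) =
      IsTransition (gapCoeff T A' B' t) t (jump T t) :=
    funext fun M => propext (h.isTransition_gap_iff ht htj)
  unfold fundamental
  rw [hfun]

theorem pullback_of_dense {t : ℝ} (ht : t ∈ dense T) : pullback T A A' B' t = B' t :=
  if_pos ht

theorem IsExtension.pullback_of_scattered (h : IsExtension T A A') {t : ℝ} (ht : t ∈ pos T)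
    (htj : t < jump T t) : pullback T A A' B' t =
      (jump T t - t)⁻¹ • (fundamental (gapCoeff T A' B' t) (jump T t) t - 1) - A t := by
  rw [pullback, if_neg (notMem_dense_of_mem_gap ⟨le_rfl, htj⟩), h.fundamental_gap ht htj,
    graininess, ← Complex.ofReal_inv, Complex.coe_smul]

theorem step_eq (t : ℝ) : step T A t = 1 + (jump T t - t) • A t := by
  rw [step, Complex.coe_smul, graininess]

theorem IsExtension.step_add_pullback (h : IsExtension T A A') {t : ℝ} (ht : t ∈ pos T)
    (htj : t < jump T t) : step T (A + pullback T A A' B') t =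
      fundamental (gapCoeff T A' B' t) (jump T t) t := by
  rw [step_eq, Pi.add_apply, h.pullback_of_scattered ht htj, add_sub_cancel,
    smul_inv_smul₀ (sub_pos.2 htj).ne', add_sub_cancel]

/-- Where the graininess tends to zero, the pullback of `B'` tends to the value of `B'`. -/
theorem IsExtension.tendsto_pullback (h : IsExtension T A A') {α δ : ℝ}
    (hT : IsTimeScale T) (hα : BoundedOn (Ici 0) A' α) (hB : ContinuousOn B' (Ici 0))
    (hδ : BoundedOn (Ici 0) B' δ) {t : ℝ} (ht : 0 ≤ t) {l : Filter ℝ} (hl : l ≤ 𝓝[pos T] t)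
    (hμ : Filter.Tendsto (graininess T) l (𝓝 0)) :
    Filter.Tendsto (pullback T A A' B') l (𝓝 (B' t)) := by
  refine Metric.tendsto_nhds.2 fun ε hε => ?_
  obtain ⟨η, hη, hclose⟩ := Metric.continuousWithinAt_iff.1 (hB t ht) (ε / 2) (half_pos hε)
  have hδ0 : 0 ≤ δ := (norm_nonneg _).trans (hδ t ht)
  have hquad : Filter.Tendsto (fun s => 2 * (α + δ) ^ 2 * Real.exp ((α + δ) * graininess T s) *
      graininess T s) l (𝓝 0) := by
    have hc : Continuous fun x : ℝ => 2 * (α + δ) ^ 2 * Real.exp ((α + δ) * x) * x := by fun_prop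
    have := (hc.tendsto 0).comp hμ
    rwa [mul_zero] at this
  have hpos : ∀ᶠ s in l, s ∈ pos T := hl self_mem_nhdsWithin
  have hnear : ∀ᶠ s in l, dist s t < η / 2 :=
    hl (mem_nhdsWithin_of_mem_nhds (Metric.ball_mem_nhds t (half_pos hη)))
  filter_upwards [hpos, hnear, hμ.eventually_lt_const (half_pos hη),
    hquad.eventually_lt_const (half_pos hε)] with s hs hst hsμ hsq
  have hcl : ∀ r ∈ Icc s (jump T s), dist (B' r) (B' t) < ε / 2 := by
    intro r hr
    refine hclose (hs.2.trans hr.1) ?_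
    have h1 : dist r s < η / 2 := by
      rw [Real.dist_eq, abs_of_nonneg (sub_nonneg.2 hr.1)]
      exact (sub_le_sub_right hr.2 s).trans_lt hsμ
    linarith [dist_triangle r s t]
  by_cases hd : s ∈ dense T
  · rw [pullback_of_dense hd]
    have := hcl s ⟨le_rfl, hT.le_jump s⟩
    linarith
  have hsj := hT.lt_jump hs.1 hd
  have hm : 0 < jump T s - s := sub_pos.2 hsj
  -- With `X = A' s` the exponential is `E + μ A(s)`, so the estimated quantity is `μ` times the
  -- pullback minus `B' t`.
  have hest := norm_fundamental_sub_exp_sub_smul_le (X := A' s) (Y := B' t)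
    (ε := ε / 2) (continuous_gapCoeff (T := T) (A' := A') hs.2 hB)
    (norm_gapCoeff_le hα hδ hs.2) hsj.le
    ((hα s hs.2).trans (le_add_of_nonneg_right hδ0)) fun r hr => by
      rw [gapCoeff_of_mem hr, add_sub_cancel_left, ← dist_eq_norm]
      exact (hcl r hr).le
  rw [h.exp_smul_eq hs hsj, step_eq] at hest
  have heq : pullback T A A' B' s - B' t = (jump T s - s)⁻¹ •
      (fundamental (gapCoeff T A' B' s) (jump T s) s - (1 + (jump T s - s) • A s) -
        (jump T s - s) • B' t) := by
    rw [h.pullback_of_scattered hs hsj, smul_sub, smul_sub, smul_sub, smul_add,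
      inv_smul_smul₀ hm.ne', inv_smul_smul₀ hm.ne']
    abel
  rw [dist_eq_norm, heq, norm_smul, norm_inv, Real.norm_of_nonneg hm.le]
  refine ((inv_mul_le_iff₀ hm).2 (hest.trans_eq (mul_comm _ _))).trans_lt ?_
  simp only [graininess] at hsq
  linarith

/-- Graininess tends to zero at right-dense points, and from the left at every point of `T`. The
left limit is `B' t` even where `t` is right-scattered and the pullback may take another value. -/
theorem IsExtension.rdContinuous_pullback (h : IsExtension T A A') {α δ : ℝ}
    (hT : IsTimeScale T) (hα : BoundedOn (Ici 0) A' α) (hB : ContinuousOn B' (Ici 0))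
    (hδ : BoundedOn (Ici 0) B' δ) : RdContinuous T (pullback T A A' B') := by
  refine ⟨fun t ht => ?_, fun t ht _ => ⟨B' t, ?_⟩⟩
  · rw [ContinuousWithinAt, pullback_of_dense ht.1]
    exact h.tendsto_pullback hT hα hB hδ ht.2 le_rfl
      ((hT.tendsto_graininess_of_dense ht.1).mono_left nhdsWithin_le_nhds)
  · exact h.tendsto_pullback hT hα hB hδ ht.2 (nhdsWithin_mono _ inter_subset_left)
      ((hT.tendsto_graininess_left ht.1).mono_left (nhdsWithin_mono _ inter_subset_right))

end Gap

/-! ### Bounds uniform in the gap length, and the left inverse -/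

section Estimates

variable {n : ℕ} {T : Set ℝ} {A A' B' : ℝ → Matrix (Fin n) (Fin n) ℂ} {a ρ α S δ : ℝ}

/-- The margin is `2 * S` because vanishing requires distance strictly greater than `S`. -/
theorem IsPerturbation.gapCoeff_eq (hT : IsTimeScale T) (hS : 0 < S)
    (hB : IsPerturbation T S δ B') {t : ℝ} (ht : 0 ≤ t) {r : ℝ}
    (hr : r ∈ Icc (t + 2 * S) (jump T t - 2 * S)) : gapCoeff T A' B' t r = A' t := by
  have h1 := hr.1
  have h2 := hr.2
  rw [gapCoeff_of_mem ⟨by linarith, by linarith⟩, hB.vanish r (by linarith)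
    (by linarith [le_infDist_of_mem_gap hT h1 h2]), add_zero]

theorem IsExtension.fundamental_long_gap (h : IsExtension T A A') (hT : IsTimeScale T) (hS : 0 < S)
    (hα : BoundedOn (Ici 0) A' α) (hB : IsPerturbation T S δ B') {t : ℝ} (ht : t ∈ pos T)
    (hμ : 4 * S < jump T t - t) :
    fundamental (gapCoeff T A' B' t) (jump T t) t =
      fundamental (gapCoeff T A' B' t) (jump T t) (jump T t - 2 * S) *
        (step T A t * NormedSpace.exp ((4 * S) • -A' t)) *
          fundamental (gapCoeff T A' B' t) (t + 2 * S) t := by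
  rw [fundamental_eq_mul_exp_mul (continuous_gapCoeff ht.2 hB.continuousOn)
    (norm_gapCoeff_le hα hB.bounded ht.2) (by linarith : t ≤ t + 2 * S)
    (by linarith : t + 2 * S ≤ jump T t - 2 * S) (by linarith : jump T t - 2 * S ≤ jump T t)
    (fun r hr => hB.gapCoeff_eq hT hS ht.2 hr), h.exp_smul_eq ht (by linarith),
    show jump T t - (jump T t - 2 * S) + (t + 2 * S - t) = 4 * S by ring]

theorem norm_exp_smul_le_of_norm_le {X : Matrix (Fin n) (Fin n) ℂ} (hX : ‖X‖ ≤ α) (hS : 0 < S) :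
    ‖NormedSpace.exp ((4 * S) • X)‖ ≤ Real.exp (4 * S * α) := by
  refine (norm_exp_smul_le X (by linarith)).trans (Real.exp_le_exp.2 ?_)
  rw [mul_comm]
  gcongr

theorem IsExtension.uniformlyRegressive_add_pullback (h : IsExtension T A A')
    (hT : IsTimeScale T) (hS : 0 < S) (hα : BoundedOn (Ici 0) A' α)
    (hρ : UniformlyRegressiveWith T A ρ) (hB : IsPerturbation T S δ B') :
    UniformlyRegressive T (A + pullback T A A' B') := by
  have hρ0 : 0 ≤ ρ := (norm_nonneg _).trans (hρ 0 ⟨hT.zero_mem, self_mem_Ici⟩).2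
  have hc0 : 0 ≤ α + δ := (norm_nonneg _).trans
    (norm_gapCoeff_le (T := T) hα hB.bounded le_rfl 0)
  set e := Real.exp ((α + δ) * (2 * S)) with he
  -- The three summands serve right-dense points, gaps of length at most `4S`, and longer gaps.
  refine ⟨1 + Real.exp ((α + δ) * (4 * S)) + e * (Real.exp (4 * S * α) * ρ) * e, fun t ht => ?_⟩
  have hp1 := Real.exp_pos ((α + δ) * (4 * S))
  have hp2 : 0 ≤ e * (Real.exp (4 * S * α) * ρ) * e := by positivity
  by_cases hd : t ∈ dense T
  · rw [step, graininess_of_dense hd, Complex.ofReal_zero, zero_smul, add_zero, inv_one]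
    exact ⟨isUnit_one, norm_one_le_one.trans (by linarith)⟩
  have htj := hT.lt_jump ht.1 hd
  have hf := continuous_gapCoeff (T := T) (A' := A') ht.2 hB.continuousOn
  have hc := norm_gapCoeff_le (T := T) hα hB.bounded ht.2
  rw [h.step_add_pullback ht htj]
  obtain ⟨hu, hi⟩ := fundamental_inverse hf hc htj.le
  refine ⟨hu, ?_⟩
  rcases le_or_gt (jump T t - t) (4 * S) with hμ | hμ
  · have : Real.exp ((α + δ) * (jump T t - t)) ≤ Real.exp ((α + δ) * (4 * S)) := by gcongr
    linarith
  · have h1 := (fundamental_inverse hf hc (by linarith : t ≤ t + 2 * S)).2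
    have h2 := (fundamental_inverse hf hc (by linarith : jump T t - 2 * S ≤ jump T t)).2
    rw [add_sub_cancel_left, ← he] at h1
    rw [sub_sub_cancel, ← he] at h2
    have h3 : (NormedSpace.exp ((4 * S) • -A' t))⁻¹ = NormedSpace.exp ((4 * S) • A' t) :=
      Matrix.inv_eq_right_inv (exp_smul_neg_mul_exp_smul _ _)
    rw [h.fundamental_long_gap hT hS hα hB ht hμ, Matrix.mul_inv_rev, Matrix.mul_inv_rev,
      Matrix.mul_inv_rev, h3, ← mul_assoc]
    refine (norm_mul_le _ _).trans ((mul_le_mul ((norm_mul_le _ _).trans (mul_le_mul h1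
      ((norm_mul_le _ _).trans (mul_le_mul (norm_exp_smul_le_of_norm_le (hα t ht.2) hS)
      (hρ t ht).2 (norm_nonneg _) (Real.exp_pos _).le)) (norm_nonneg _) (Real.exp_pos _).le))
      h2 (norm_nonneg _) (by positivity)).trans ?_)
    linarith

/-- A Lipschitz constant for the pullback. -/
noncomputable def lipschitzBound (a α S δ : ℝ) : ℝ :=
  1 + Real.exp ((α + δ) * (4 * S)) ^ 3 +
    Real.exp ((α + δ) * (2 * S)) ^ 4 * Real.exp (4 * S * α) * (1 + 4 * S * |a|)

theorem one_le_lipschitzBound (hS : 0 < S) : 1 ≤ lipschitzBound a α S δ := by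
  rw [lipschitzBound, add_assoc]
  exact le_add_of_nonneg_right (by positivity)

/-- Of the summands of `lipschitzBound`, the second serves gaps of length at most `4S` and the third
longer ones; the `1` is for right-dense points. The factor `jump T t - t` on the right cancels the
division by `μ` in the pullback. -/
theorem IsExtension.norm_fundamental_gap_sub_le (h : IsExtension T A A') (hT : IsTimeScale T)
    (hS : 0 < S) (ha : BoundedOn (pos T) A a) (hα : BoundedOn (Ici 0) A' α)
    {B₁ B₂ : ℝ → Matrix (Fin n) (Fin n) ℂ} (hB₁ : IsPerturbation T S δ B₁)
    (hB₂ : IsPerturbation T S δ B₂) {ε : ℝ} (hε : BoundedOn (Ici 0) (B₁ - B₂) ε)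
    {t : ℝ} (ht : t ∈ pos T) (htj : t < jump T t) :
    ‖fundamental (gapCoeff T A' B₁ t) (jump T t) t -
      fundamental (gapCoeff T A' B₂ t) (jump T t) t‖ ≤
        (jump T t - t) * (lipschitzBound a α S δ * ε) := by
  have hε0 : 0 ≤ ε := (norm_nonneg _).trans (hε t ht.2)
  have hm : 0 < jump T t - t := sub_pos.2 htj
  have hf₁ := continuous_gapCoeff (T := T) (A' := A') ht.2 hB₁.continuousOn
  have hf₂ := continuous_gapCoeff (T := T) (A' := A') ht.2 hB₂.continuousOn
  have hc₁ := norm_gapCoeff_le (T := T) hα hB₁.bounded ht.2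
  have hc₂ := norm_gapCoeff_le (T := T) hα hB₂.bounded ht.2
  have hc0 : 0 ≤ α + δ := (norm_nonneg _).trans (hc₁ 0)
  have hdiff : ∀ r, ‖gapCoeff T A' B₁ t r - gapCoeff T A' B₂ t r‖ ≤ ε := fun r => by
    rw [gapCoeff, gapCoeff, add_sub_add_left_eq_sub]
    exact hε (max t (min (jump T t) r)) (mem_Ici.2 (ht.2.trans (le_max_left _ _)))
  have ha0 : ‖A t‖ ≤ |a| := (ha t ht).trans (le_abs_self a)
  rw [lipschitzBound]
  rcases le_or_gt (jump T t - t) (4 * S) with hμ | hμ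
  · refine (norm_fundamental_sub_le hf₁ hf₂ hc₁ hc₂ htj.le fun r _ => hdiff r).trans ?_
    rw [mul_comm _ (jump T t - t), mul_assoc]
    gcongr
    have h1 : Real.exp ((α + δ) * (jump T t - t)) ^ 3 ≤ Real.exp ((α + δ) * (4 * S)) ^ 3 := by
      gcongr
    have h2 : 0 ≤ Real.exp ((α + δ) * (2 * S)) ^ 4 * Real.exp (4 * S * α) * (1 + 4 * S * |a|) := by
      positivity
    linarith
  · have hl : t ≤ t + 2 * S := by linarith
    have hr : jump T t - 2 * S ≤ jump T t := by linarith
    have hl₁ := norm_fundamental_le hf₁ hc₁ hl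
    have hr₂ := norm_fundamental_le hf₂ hc₂ hr
    have hls := norm_fundamental_sub_le hf₁ hf₂ hc₁ hc₂ hl fun r _ => hdiff r
    have hrs := norm_fundamental_sub_le hf₁ hf₂ hc₁ hc₂ hr fun r _ => hdiff r
    rw [add_sub_cancel_left] at hl₁ hls
    rw [sub_sub_cancel] at hr₂ hrs
    have hmid : ‖step T A t * NormedSpace.exp ((4 * S) • -A' t)‖ ≤
        (1 + (jump T t - t) * |a|) * Real.exp (4 * S * α) := by
      refine (norm_mul_le _ _).trans (mul_le_mul ?_
        (norm_exp_smul_le_of_norm_le ((norm_neg _).trans_le (hα t ht.2)) hS) (norm_nonneg _)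
        (by positivity))
      rw [step_eq]
      refine (norm_add_le _ _).trans (add_le_add norm_one_le_one ?_)
      rw [norm_smul, Real.norm_of_nonneg hm.le]
      gcongr
    rw [h.fundamental_long_gap hT hS hα hB₁ ht hμ, h.fundamental_long_gap hT hS hα hB₂ ht hμ]
    set e := Real.exp ((α + δ) * (2 * S))
    set N := step T A t * NormedSpace.exp ((4 * S) • -A' t)
    set L₁ := fundamental (gapCoeff T A' B₁ t) (t + 2 * S) t
    set L₂ := fundamental (gapCoeff T A' B₂ t) (t + 2 * S) t
    set R₁ := fundamental (gapCoeff T A' B₁ t) (jump T t) (jump T t - 2 * S)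
    set R₂ := fundamental (gapCoeff T A' B₂ t) (jump T t) (jump T t - 2 * S)
    set m := jump T t - t
    set k := (1 + m * |a|) * Real.exp (4 * S * α) with hk
    have hk0 : 0 ≤ k := by positivity
    have he0 : 0 < e := Real.exp_pos _
    have heq : R₁ * N * L₁ - R₂ * N * L₂ = (R₁ - R₂) * N * L₁ + R₂ * N * (L₁ - L₂) := by
      noncomm_ring
    have hb1 : ‖(R₁ - R₂) * N * L₁‖ ≤ e ^ 3 * (2 * S) * ε * k * e :=
      (norm_mul_le _ _).trans (mul_le_mul ((norm_mul_le _ _).trans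
        (mul_le_mul hrs hmid (norm_nonneg _) (by positivity))) hl₁ (norm_nonneg _) (by positivity))
    have hb2 : ‖R₂ * N * (L₁ - L₂)‖ ≤ e * k * (e ^ 3 * (2 * S) * ε) :=
      (norm_mul_le _ _).trans (mul_le_mul ((norm_mul_le _ _).trans
        (mul_le_mul hr₂ hmid (norm_nonneg _) he0.le)) hls (norm_nonneg _) (by positivity))
    rw [heq]
    -- This is `4S ≤ m`: on a long gap, the linear growth of `E + μ A` is at most a constant times
    -- the gap length.
    have hs1 : 4 * S * (1 + m * |a|) ≤ m * (1 + 4 * S * |a|) := by linarith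
    calc ‖(R₁ - R₂) * N * L₁ + R₂ * N * (L₁ - L₂)‖
        ≤ e ^ 3 * (2 * S) * ε * k * e + e * k * (e ^ 3 * (2 * S) * ε) :=
          (norm_add_le _ _).trans (add_le_add hb1 hb2)
      _ = e ^ 4 * Real.exp (4 * S * α) * ε * (4 * S * (1 + m * |a|)) := by
          rw [hk]
          ring
      _ ≤ e ^ 4 * Real.exp (4 * S * α) * ε * (m * (1 + 4 * S * |a|)) := by gcongr
      _ = m * (e ^ 4 * Real.exp (4 * S * α) * (1 + 4 * S * |a|) * ε) := by ring
      _ ≤ _ := by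
          gcongr
          exact le_add_of_nonneg_left (by positivity)

theorem IsExtension.boundedOn_pullback_sub (h : IsExtension T A A') (hT : IsTimeScale T)
    (hS : 0 < S) (ha : BoundedOn (pos T) A a) (hα : BoundedOn (Ici 0) A' α)
    {B₁ B₂ : ℝ → Matrix (Fin n) (Fin n) ℂ} (hB₁ : IsPerturbation T S δ B₁)
    (hB₂ : IsPerturbation T S δ B₂) {ε : ℝ} (hε : BoundedOn (Ici 0) (B₁ - B₂) ε) :
    BoundedOn (pos T) (pullback T A A' B₁ - pullback T A A' B₂) (lipschitzBound a α S δ * ε) := by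
  intro t ht
  by_cases hd : t ∈ dense T
  · rw [Pi.sub_apply, pullback_of_dense hd, pullback_of_dense hd]
    exact (hε t ht.2).trans
      (le_mul_of_one_le_left ((norm_nonneg _).trans (hε t ht.2)) (one_le_lipschitzBound hS))
  have htj := hT.lt_jump ht.1 hd
  have hm : 0 < jump T t - t := sub_pos.2 htj
  rw [Pi.sub_apply, h.pullback_of_scattered ht htj, h.pullback_of_scattered ht htj,
    sub_sub_sub_cancel_right, ← smul_sub, sub_sub_sub_cancel_right, norm_smul, norm_inv,
    Real.norm_of_nonneg hm.le, inv_mul_le_iff₀ hm]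
  exact h.norm_fundamental_gap_sub_le hT hS ha hα hB₁ hB₂ hε ht htj

/-- `C - A'` need be neither continuous nor bounded, so the results for perturbations do not apply;
constancy of `C` on the gap suffices. -/
theorem IsExtension.existsUnique_isTransition_self {C : ℝ → Matrix (Fin n) (Fin n) ℂ}
    (h : IsExtension T A C) {t : ℝ} (ht : t ∈ pos T) (htj : t < jump T t) :
    ∃! M, IsTransition C t (jump T t) M := by
  obtain ⟨M, hM, hM'⟩ := TimeScale.existsUnique_isTransition (continuous_const (y := C t))
    (fun _ => le_rfl) htj.le
  exact ⟨M, hM.congr htj.le (h.eqOn_gap ht).symm, fun N hN =>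
    hM' N (hN.congr htj.le (h.eqOn_gap ht))⟩

theorem IsExtension.fundamental_self {C : ℝ → Matrix (Fin n) (Fin n) ℂ}
    (h : IsExtension T A C) {t : ℝ} (ht : t ∈ pos T) (htj : t < jump T t) :
    fundamental C (jump T t) t = step T A t := by
  have hex := TimeScale.existsUnique_isTransition (continuous_const (y := C t))
    (fun _ => le_rfl) htj.le
  obtain ⟨M, hM, -⟩ := id hex
  rw [fundamental_eq (h.existsUnique_isTransition_self ht htj)
    (hM.congr htj.le (h.eqOn_gap ht).symm), ← fundamental_eq hex hM,
    fundamental_of_const continuous_const (fun _ => le_rfl) htj.le fun _ _ => rfl,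
    h.exp_smul_eq ht htj]

theorem IsExtension.eqOn_pullback_sub {B C : ℝ → Matrix (Fin n) (Fin n) ℂ} (hT : IsTimeScale T)
    (h : IsExtension T A A') (hC : IsExtension T (A + B) C) :
    EqOn (pullback T A A' (C - A')) B (pos T) := by
  intro t ht
  by_cases hd : t ∈ dense T
  · rw [pullback_of_dense hd, Pi.sub_apply, h.eq_of_dense t ht.2 hd, hC.eq_of_dense t ht.2 hd,
      Pi.add_apply, add_sub_cancel_left]
  have htj := hT.lt_jump ht.1 hd
  rw [pullback, if_neg hd, add_sub_cancel, hC.fundamental_self ht htj, step, add_sub_cancel_left,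
    inv_smul_smul₀ (Complex.ofReal_ne_zero.2 (show graininess T t ≠ 0 from (sub_pos.2 htj).ne')), Pi.add_apply,
    add_sub_cancel_left]

end Estimates

end TimeScale

theorem theorem5p3 (n : ℕ) (a ρ α S : ℝ) (hS : 0 < S) :
    ∃ δ₀ : ℝ, 0 < δ₀ ∧ ∀ δ : ℝ, 0 < δ → δ ≤ δ₀ → ∃ K : ℝ, 0 ≤ K ∧
      ∀ (T : Set ℝ) (A A' : ℝ → Matrix (Fin n) (Fin n) ℂ),
        TimeScale.IsTimeScale T →
        TimeScale.RdContinuous T A →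
        TimeScale.BoundedOn (TimeScale.pos T) A a →
        TimeScale.UniformlyRegressiveWith T A ρ →
        TimeScale.IsExtension T A A' →
        TimeScale.BoundedOn (Set.Ici 0) A' α →
        -- the formula defines an rd-continuous matrix function `B`, with `A + B` uniformly regressive
        (∀ B', TimeScale.IsPerturbation T S δ B' →
          TimeScale.PullbackDefined T A' B' ∧
          TimeScale.RdContinuous T (TimeScale.pullback T A A' B') ∧
          TimeScale.UniformlyRegressive T (A + TimeScale.pullback T A A' B')) ∧
        -- the operator is Lipschitz in the sup norms, with the constant `K`
        (∀ B₁ B₂, TimeScale.IsPerturbation T S δ B₁ → TimeScale.IsPerturbation T S δ B₂ →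
          ∀ ε : ℝ, TimeScale.BoundedOn (Set.Ici 0) (B₁ - B₂) ε →
            TimeScale.BoundedOn (TimeScale.pos T)
              (TimeScale.pullback T A A' B₁ - TimeScale.pullback T A A' B₂) (K * ε)) ∧
        -- the operator is a left inverse of the map `B ↦ C - A'`, `C` an extension of `A + B`
        (∀ B C, TimeScale.RdContinuous T B → TimeScale.UniformlyRegressive T (A + B) →
          TimeScale.IsExtension T (A + B) C →
            TimeScale.PullbackDefined T A' (C - A') ∧
            Set.EqOn (TimeScale.pullback T A A' (C - A')) B (TimeScale.pos T)) := by
  -- The value `1` is arbitrary: linear equations are solvable with invertible transition matrices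
  -- whatever the size of the perturbation, and `δ` enters only the constants.
  refine ⟨1, one_pos, fun δ _ _ => ⟨TimeScale.lipschitzBound a α S δ,
    zero_le_one.trans (TimeScale.one_le_lipschitzBound hS), ?_⟩⟩
  intro T A A' hT _ ha hρ hA' hα
  refine ⟨fun B' hB => ⟨fun t ht => ?_, ?_, ?_⟩, fun B₁ B₂ hB₁ hB₂ ε hε => ?_,
    fun B C _ _ hC => ⟨fun t ht => ?_, ?_⟩⟩
  · exact hA'.existsUnique_isTransition hα hB.continuousOn hB.bounded ⟨ht.1.1, ht.2⟩ ht.1.2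
  · exact hA'.rdContinuous_pullback hT hα hB.continuousOn hB.bounded
  · exact hA'.uniformlyRegressive_add_pullback hT hS hα hρ hB
  · exact hA'.boundedOn_pullback_sub hT hS ha hα hB₁ hB₂ hε
  · rw [add_sub_cancel]
    exact hC.existsUnique_isTransition_self ⟨ht.1.1, ht.2⟩ ht.1.2
  · exact hA'.eqOn_pullback_sub hT hC
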